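/- Let $1\le k<n$, let $\mathcal Y=\{1,\dots,n\}$ with probability simplex $\Delta_{\mathcal Y}$, and write $v_{[i]}$ for the $i$-th largest entry of $v\in\mathbb R^n$. Let $$L_2(u,y)=\Bigl(1-u_y+\frac1k\sum_{i=1}^k (u-e_y)_{[i]}\Bigr)_+,\qquad u\in\mathbb R^n,\ y\in\mathcal Y .$$ For a loss $\ell:\mathcal R\times\mathcal Y\to\mathbb R_+$ and $p\in\Delta_{\mathcal Y}$ let $\mathrm{prop}[\ell](p)=\arg\min_{r\in\mathcal R}\sum_y p_y\,\ell(r,y)$. A set $\mathcal S\subseteq\mathcal R$ is representative for $\ell$ if $\mathrm{prop}[\ell](p)\cap\mathcal S\neq\emptyset$ for all $p\in\Delta_{\mathcal Y}$. A loss $L:\mathbb R^d\times\mathcal Y\to\mathbb R_+$ embeds a loss $\ell:\mathcal R\times\mathcal Y\to\mathbb R_+$ with $\mathcal R$ finite if there are a representative set $\mathcal S$ for $\ell$ and an injective map $\varphi:\mathcal S\to\mathbb R^d$ such that $L(\varphi(r),y)=\ell(r,y)$ for all $r\in\mathcal S$, $y\in\mathcal Y$, and $r\in\mathrm{prop}[\ell](p)\iff\varphi(r)\in\mathrm{prop}[L](p)$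 for all $r\in\mathcal S$, $p\in\Delta_{\mathcal Y}$. Let $\mathcal P_2$ be the set of pairs $(H,M)$ of disjoint subsets of $\mathcal Y$ with $|H\cup M|\le k$ and $|H|<k$; for $(H,M)\in\mathcal P_2$ put $$u_{H,M}=\frac{|M|+k-1}{k-|H|}\,\mathbf 1_H+\mathbf 1_M\in\mathbb R^n,\qquad R_2=\{u_{H,M}:(H,M)\in\mathcal P_2\},$$ and $$\hat\ell_2((H,M),y)=\begin{cases}0,& y\in H,\\[2pt] \dfrac{|H|+|M|-1}{k-|H|},& y\in M,\\[6pt] \dfrac{|H|+|M|-1}{k-|H|}+\dfrac{k+1}{k},&\text{otherwise.}\end{cases}$$ Then: 1. $R_2$ is a finite representative set for $L_2$; 2. $L_2$ embeds its restriction $L_2|_{R_2}$; 3. $L_2(u_{H,M},y)=\hat\ell_2((H,M),y)$ for all $(H,M)\in\mathcal P_2$ and $y\in\mathcal Y$; 4. $L_2$ embeds $\hat\ell_2:\mathcal P_2\times\mathcal Y\to\mathbb R_+$. -/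

import Mathlib

/-- The expected loss `𝔼_{Y ∼ p} ℓ(r, Y)` of the report `r`, for weights `p` on a finite label set. -/
def expectedLoss {R Y : Type*} [Fintype Y] (ℓ : R → Y → ℝ) (p : Y → ℝ) (r : R) : ℝ :=
  ∑ y, p y * ℓ r y

/-- The property elicited by the loss `ℓ`: the set of minimizers of the expected loss under `p`. -/
def elicitedProp {R Y : Type*} [Fintype Y] (ℓ : R → Y → ℝ) (p : Y → ℝ) : Set R :=
  {r | ∀ r' : R, expectedLoss ℓ p r ≤ expectedLoss ℓ p r'}

/-- `S` is representative for `ℓ`: for every label distribution, some element of `S` is optimal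
among all reports. -/
def IsRepresentative {R Y : Type*} [Fintype Y] (ℓ : R → Y → ℝ) (S : Set R) : Prop :=
  ∀ p ∈ stdSimplex ℝ Y, (elicitedProp ℓ p ∩ S).Nonempty

/-- The nonnegative loss `L` on `ℝᵈ` embeds the nonnegative discrete (finite report set)
loss `ℓ`. -/
def Embeds {R Y : Type*} [Fintype Y] {d : ℕ} (L : (Fin d → ℝ) → Y → ℝ) (ℓ : R → Y → ℝ) : Prop :=
  (∀ u y, 0 ≤ L u y) ∧ Finite R ∧ (∀ r y, 0 ≤ ℓ r y) ∧
    ∃ S : Set R, IsRepresentative ℓ S ∧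
      ∃ φ : S → (Fin d → ℝ), Function.Injective φ ∧
        (∀ (r : S) (y : Y), L (φ r) y = ℓ r y) ∧
        (∀ p ∈ stdSimplex ℝ Y, ∀ r : S, (r : R) ∈ elicitedProp ℓ p ↔ φ r ∈ elicitedProp L p)

/-- The restriction of a loss to a set of reports. -/
def restrictLoss {R Y : Type*} (L : R → Y → ℝ) (S : Set R) : S → Y → ℝ :=
  fun r y => L r y

/-- `sortedDesc u i` is the `(i+1)`-st largest entry of `u`, counted with multiplicity. -/
noncomputable def sortedDesc {n : ℕ} (u : Fin n → ℝ) (i : Fin n) : ℝ :=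
  u (Tuple.sort (fun j => -u j) i)

/-- The surrogate `L₂(u, y) = (1 - u_y + (1/k) ∑_{i=1}^k (u - e_y)_{[i]})₊`. -/
noncomputable def surrogateL2 (n k : ℕ) (u : Fin n → ℝ) (y : Fin n) : ℝ :=
  max (1 - u y + (1 / (k : ℝ)) *
    ∑ i : Fin n with i.val < k, sortedDesc (u - Pi.single y (1 : ℝ)) i) 0

/-- The pairs `(H, M)` of disjoint label sets with `|H ∪ M| ≤ k` and `|H| < k`. -/
abbrev HighMedium (n k : ℕ) : Type :=
  {r : Finset (Fin n) × Finset (Fin n) //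
    Disjoint r.1 r.2 ∧ (r.1 ∪ r.2).card ≤ k ∧ r.1.card < k}

/-- The discrete loss `ℓ̂₂`. -/
noncomputable def hatEll2 (n k : ℕ) (r : HighMedium n k) (y : Fin n) : ℝ :=
  if y ∈ r.1.1 then 0
  else if y ∈ r.1.2 then
    ((r.1.1.card : ℝ) + (r.1.2.card : ℝ) - 1) / ((k : ℝ) - (r.1.1.card : ℝ))
  else
    ((r.1.1.card : ℝ) + (r.1.2.card : ℝ) - 1) / ((k : ℝ) - (r.1.1.card : ℝ))
      + ((k : ℝ) + 1) / (k : ℝ)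

/-- The vector `((|M| + k - 1) / (k - |H|)) · 1_H + 1_M`. -/
noncomputable def vertexPoint (n k : ℕ) (r : HighMedium n k) : Fin n → ℝ :=
  (((r.1.2.card : ℝ) + (k : ℝ) - 1) / ((k : ℝ) - (r.1.1.card : ℝ))) •
      Set.indicator (r.1.1 : Set (Fin n)) (1 : Fin n → ℝ)
    + Set.indicator (r.1.2 : Set (Fin n)) (1 : Fin n → ℝ)

/-- The set `R₂` of all these vectors. -/
def vertexSetR2 (n k : ℕ) : Set (Fin n → ℝ) :=
  Set.range (vertexPoint n k)

/-!
Let `t` be the `(k+1)`-st largest entry of `u` and let `w = (u - t)₊` be the excess over it.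
Exchanging `y` for a label with entry `t` shows that the `k` largest entries of `u - e_y` sum to
`k t + ∑ w - min(w_y, 1)`. Hence, with `s = (∑ w - 1) / k`, the loss at `y` is at least
`(s - (w_y - 1))₊` if `w_y ≥ 1` and at least `(s + (k+1)/k (1 - w_y))₊` if `w_y ≤ 1`. Put
`b = min(w, 1)`. If `∑ b > 1`, these are bounded below by `s (1 - a_y) + (k+1)/k (1 - b_y)` with
`a = min(1, (w - 1)₊ / s)`, so that `a` and `b` are fractional versions of `H` and `H ∪ M`, and
`∑ b - 1 ≤ s (k - ∑ a)`; if `∑ b ≤ 1`, the same holds with `a = 0` and `min(s, 0)` in place of `s`.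

Subtract a constant `V` from the expectation of this bound and multiply by `k - ∑ a`. The result is
at least an expression affine in `a` and in `b` separately, so both can be rounded to indicators of
sets `H ⊆ B` without increasing that expression. If `|H| < k` then `(H, B \ H)` belongs to `𝒫₂`, and
the expression is nonnegative when `V` is the least expected `ℓ̂₂`-loss; if `|H| = k` it is
nonnegative for any `V`.
-/

section TopSets

variable {ι : Type*}

/-- `A` consists of labels with largest entries of `v`, ties being broken arbitrarily. -/
def IsTopSet {M : Type*} [LE M] (v : ι → M) (A : Finset ι) : Prop :=
  ∀ i ∈ A, ∀ j ∉ A, v j ≤ v i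

lemma IsTopSet.sum_le_sum {M : Type*} [AddCommGroup M] [LinearOrder M] [IsOrderedAddMonoid M]
    {v : ι → M} {A B : Finset ι} (hA : IsTopSet v A) (hcard : B.card = A.card) :
    ∑ i ∈ B, v i ≤ ∑ i ∈ A, v i := by
  classical
  have hcard' : (B \ A).card = (A \ B).card := Finset.card_sdiff_comm hcard
  rw [← Finset.sum_sdiff_le_sum_sdiff]
  rcases (A \ B).eq_empty_or_nonempty with hAB | hAB
  · rw [hAB, Finset.card_empty, Finset.card_eq_zero] at hcard'
    rw [hAB, hcard']
  · obtain ⟨m, hm, hmin⟩ := (A \ B).exists_min_image v hAB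
    calc ∑ i ∈ B \ A, v i ≤ (B \ A).card • v m :=
          Finset.sum_le_card_nsmul _ _ _ fun i hi =>
            hA m (Finset.mem_sdiff.1 hm).1 i (Finset.mem_sdiff.1 hi).2
      _ = (A \ B).card • v m := by rw [hcard']
      _ ≤ ∑ i ∈ A \ B, v i := Finset.card_nsmul_le_sum _ _ _ hmin

/-- `A` is a top set for `u`, and `j` carries a largest entry of `u` outside `A`; so `u j` is the
`(|A| + 1)`-st largest entry of `u`. -/
structure IsCutoff {M : Type*} [LE M] (u : ι → M) (A : Finset ι) (j : ι) : Prop where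
  notMem : j ∉ A
  le_of_mem : ∀ i ∈ A, u j ≤ u i
  le_of_notMem : ∀ i ∉ A, u i ≤ u j

lemma IsTopSet.exists_isCutoff [Fintype ι] {M : Type*} [LinearOrder M] {u : ι → M} {A : Finset ι}
    (hA : IsTopSet u A) (hcard : A.card < Fintype.card ι) : ∃ j, IsCutoff u A j := by
  classical
  obtain ⟨j, hj, hmax⟩ := Aᶜ.exists_max_image u
    (Finset.card_pos.1 (by rw [Finset.card_compl]; omega))
  rw [Finset.mem_compl] at hj
  exact ⟨j, hj, fun i hi => hA i hi j hj, fun i hi => hmax i (Finset.mem_compl.2 hi)⟩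

lemma sum_le_card_mul_add_sum_max [Fintype ι] (v : ι → ℝ) (B : Finset ι) (t : ℝ) :
    ∑ i ∈ B, v i ≤ B.card * t + ∑ i, max (v i - t) 0 := by
  calc ∑ i ∈ B, v i = B.card * t + ∑ i ∈ B, (v i - t) := by simp [Finset.sum_sub_distrib]
    _ ≤ B.card * t + ∑ i ∈ B, max (v i - t) 0 := by gcongr; exact le_max_left _ _
    _ ≤ B.card * t + ∑ i, max (v i - t) 0 := by
      gcongr
      exact Finset.subset_univ B

lemma IsCutoff.sum_eq [Fintype ι] {u : ι → ℝ} {A : Finset ι} {j : ι} (h : IsCutoff u A j) :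
    ∑ i ∈ A, u i = A.card * u j + ∑ i, max (u i - u j) 0 := by
  rw [← Finset.sum_subset (Finset.subset_univ A) fun i _ hi =>
      max_eq_right (sub_nonpos.2 (h.le_of_notMem i hi)),
    Finset.sum_congr rfl fun i hi => max_eq_left (sub_nonneg.2 (h.le_of_mem i hi))]
  simp [Finset.sum_sub_distrib]

lemma sum_max_sub_single [Fintype ι] [DecidableEq ι] (u : ι → ℝ) (y : ι) (t : ℝ) :
    ∑ i, max ((u - Pi.single y 1 : ι → ℝ) i - t) 0 =
      ∑ i, max (u i - t) 0 - min (max (u y - t) 0) 1 := by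
  have hterm : ∀ i, max ((u - Pi.single y 1 : ι → ℝ) i - t) 0 =
      max (u i - t) 0 - (Pi.single y (min (max (u y - t) 0) 1) : ι → ℝ) i := by
    intro i
    rcases eq_or_ne i y with rfl | hi
    · simp only [Pi.sub_apply, Pi.single_eq_same]
      grind
    · simp [hi]
  simp only [hterm, Finset.sum_sub_distrib, Finset.sum_pi_single', Finset.mem_univ, if_true]

end TopSets

section TopSum

variable {n k : ℕ}

/-- The sum of the `k` largest entries of `v`. -/
noncomputable def topSum (k : ℕ) (v : Fin n → ℝ) : ℝ :=
  ∑ i : Fin n with i.val < k, sortedDesc v i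

lemma sortedDesc_antitone (v : Fin n → ℝ) : Antitone (sortedDesc v) := fun _ _ hij =>
  neg_le_neg_iff.1 (Tuple.monotone_sort (fun j => -v j) hij)

lemma exists_isTopSet_topSum_eq (hkn : k ≤ n) (v : Fin n → ℝ) :
    ∃ A : Finset (Fin n), A.card = k ∧ IsTopSet v A ∧ topSum k v = ∑ i ∈ A, v i := by
  set σ := Tuple.sort fun j => -v j
  refine ⟨(Finset.univ.filter fun i : Fin n => i.val < k).map σ.toEmbedding, ?_, ?_, ?_⟩
  · rw [Finset.card_map, Fin.card_filter_val_lt, min_eq_right hkn]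
  · intro i hi j hj
    obtain ⟨x, rfl⟩ := σ.surjective i
    obtain ⟨z, rfl⟩ := σ.surjective j
    simp only [Finset.mem_map_equiv, Equiv.symm_apply_apply, Finset.mem_filter_univ] at hi hj
    exact sortedDesc_antitone v (Fin.le_def.2 (hi.le.trans (not_lt.1 hj)))
  · rw [Finset.sum_map]
    rfl

lemma sum_le_topSum (v : Fin n → ℝ) (B : Finset (Fin n)) : ∑ i ∈ B, v i ≤ topSum B.card v := by
  obtain ⟨A, hcard, hA, hsum⟩ := exists_isTopSet_topSum_eq (card_finset_fin_le B) v
  exact hsum ▸ hA.sum_le_sum hcard.symm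

lemma topSum_le (hkn : k ≤ n) (v : Fin n → ℝ) (t : ℝ) :
    topSum k v ≤ k * t + ∑ i, max (v i - t) 0 := by
  obtain ⟨A, rfl, -, hsum⟩ := exists_isTopSet_topSum_eq hkn v
  exact hsum ▸ sum_le_card_mul_add_sum_max v A t

lemma IsCutoff.topSum_sub_single {u : Fin n → ℝ} {A : Finset (Fin n)} {j : Fin n}
    (h : IsCutoff u A j) (y : Fin n) :
    topSum A.card (u - Pi.single y (1 : ℝ)) =
      A.card * u j + ∑ i, max (u i - u j) 0 - min (max (u y - u j) 0) 1 := by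
  refine le_antisymm ?_ ?_
  · have hle := topSum_le (card_finset_fin_le A) (u - Pi.single y (1 : ℝ)) (u j)
    rw [sum_max_sub_single] at hle
    linarith
  rw [← h.sum_eq]
  have hsum (B : Finset (Fin n)) : ∑ i ∈ B, (u - Pi.single y 1 : Fin n → ℝ) i =
      ∑ i ∈ B, u i - if y ∈ B then 1 else 0 := by
    simp [Finset.sum_sub_distrib]
  have hA := sum_le_topSum (u - Pi.single y (1 : ℝ)) A
  rw [hsum] at hA
  by_cases hy : y ∈ A
  · rw [if_pos hy] at hA
    have hj : j ∉ A.erase y := fun hj => h.notMem (Finset.mem_of_mem_erase hj)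
    have hyj : y ≠ j := fun hyj => h.notMem (hyj ▸ hy)
    have hswap := sum_le_topSum (u - Pi.single y (1 : ℝ)) (insert j (A.erase y))
    rw [Finset.card_insert_of_notMem hj, Finset.card_erase_add_one hy, hsum,
      if_neg (by simp [hyj]), Finset.sum_insert hj] at hswap
    have herase := Finset.add_sum_erase A u hy
    rw [max_eq_left (sub_nonneg.2 (h.le_of_mem y hy))]
    rcases min_choice (u y - u j) 1 with hmin | hmin <;> linarith
  · rw [if_neg hy] at hA
    simpa [max_eq_right (sub_nonpos.2 (h.le_of_notMem y hy))] using hA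

end TopSum

section ExcessLoss

variable {ι : Type*} [Fintype ι]

/-- The number `s = (∑ w - 1) / k`; at the vertex `u_{H,M}` it is the loss at a medium label. -/
noncomputable def excessLevel (k : ℕ) (w : ι → ℝ) : ℝ :=
  (∑ i, w i - 1) / k

/-- The surrogate loss of nonnegative scores `w` of which at most `k` are positive. For arbitrary
scores, with `w` their excess over the `(k+1)`-st largest one, it is a lower bound. -/
noncomputable def excessLoss (k : ℕ) (w : ι → ℝ) (y : ι) : ℝ :=
  max (1 - w y + (∑ i, w i - min (w y) 1) / k) 0

lemma excessLoss_of_one_le {k : ℕ} {w : ι → ℝ} {y : ι} (hy : 1 ≤ w y) :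
    excessLoss k w y = max (excessLevel k w - (w y - 1)) 0 := by
  rw [excessLoss, excessLevel, min_eq_right hy]
  congr 1
  ring

lemma excessLoss_of_le_one {k : ℕ} (hk : k ≠ 0) {w : ι → ℝ} {y : ι} (hy : w y ≤ 1) :
    excessLoss k w y = max (excessLevel k w + ((k : ℝ) + 1) / k * (1 - w y)) 0 := by
  rw [excessLoss, excessLevel, min_eq_left hy]
  congr 1
  field_simp
  ring

lemma neg_one_div_le_excessLevel (k : ℕ) {w : ι → ℝ} (hw : 0 ≤ w) :
    -(1 / (k : ℝ)) ≤ excessLevel k w := by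
  rw [excessLevel, ← neg_div]
  gcongr
  linarith [Finset.sum_nonneg fun i (_ : i ∈ Finset.univ) => hw i]

end ExcessLoss

section Surrogate

variable {n k : ℕ}

lemma surrogateL2_nonneg (u : Fin n → ℝ) (y : Fin n) : 0 ≤ surrogateL2 n k u y :=
  le_max_right _ _

lemma IsCutoff.surrogateL2_eq {u : Fin n → ℝ} {A : Finset (Fin n)} {j : Fin n}
    (h : IsCutoff u A j) (hA : A.card ≠ 0) (y : Fin n) :
    surrogateL2 n A.card u y =
      max (1 - (u y - u j) +
        (∑ i, max (u i - u j) 0 - min (max (u y - u j) 0) 1) / A.card) 0 := by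
  have hA' : (A.card : ℝ) ≠ 0 := Nat.cast_ne_zero.2 hA
  change max (1 - u y + 1 / (A.card : ℝ) * topSum A.card (u - Pi.single y (1 : ℝ))) 0 = _
  rw [h.topSum_sub_single]
  congr 1
  field_simp
  ring

lemma surrogateL2_eq_excessLoss (hk : 1 ≤ k) (hkn : k < n) {w : Fin n → ℝ} (hw : 0 ≤ w)
    {B : Finset (Fin n)} (hB : B.card ≤ k) (hwB : ∀ i ∉ B, w i = 0) (y : Fin n) :
    surrogateL2 n k w y = excessLoss k w y := by
  obtain ⟨A, hBA, rfl⟩ := Finset.exists_superset_card_eq hB (by simpa using hkn.le)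
  obtain ⟨j, hj⟩ : ∃ j, j ∉ A := by
    by_contra! hall
    simp [Finset.eq_univ_iff_forall.2 hall] at hkn
  have hwA : ∀ i ∉ A, w i = 0 := fun i hi => hwB i fun hiB => hi (hBA hiB)
  have hcut : IsCutoff w A j :=
    ⟨hj, fun i _ => (hwA j hj).trans_le (hw i), fun i hi => by rw [hwA i hi, hwA j hj]⟩
  have hpos (i : Fin n) : max (w i) 0 = w i := max_eq_left (hw i)
  rw [hcut.surrogateL2_eq (Nat.one_le_iff_ne_zero.1 hk)]
  simp only [hwA j hj, sub_zero, hpos, excessLoss]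

lemma exists_excessLoss_le_surrogateL2 (hk : 1 ≤ k) (hkn : k < n) (u : Fin n → ℝ) :
    ∃ (w : Fin n → ℝ) (A : Finset (Fin n)), 0 ≤ w ∧ A.card = k ∧ (∀ i ∉ A, w i = 0) ∧
      ∀ y, excessLoss k w y ≤ surrogateL2 n k u y := by
  obtain ⟨A, rfl, hA, -⟩ := exists_isTopSet_topSum_eq hkn.le u
  obtain ⟨j, hj⟩ := hA.exists_isCutoff (by simpa using hkn)
  refine ⟨fun i => max (u i - u j) 0, A, fun i => le_max_right _ _, rfl,
    fun i hi => max_eq_right (sub_nonpos.2 (hj.le_of_notMem i hi)), fun y => ?_⟩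
  rw [hj.surrogateL2_eq (Nat.one_le_iff_ne_zero.1 hk), excessLoss]
  gcongr
  exact le_max_left _ _

end Surrogate

section Vertices

variable {n k : ℕ}

lemma sum_vertexPoint (r : HighMedium n k) :
    ∑ i, vertexPoint n k r i =
      ((r.1.2.card : ℝ) + k - 1) / ((k : ℝ) - r.1.1.card) * r.1.1.card + r.1.2.card := by
  simp [vertexPoint, Finset.sum_add_distrib, Set.indicator_apply, mul_comm]

lemma HighMedium.sub_card_pos (r : HighMedium n k) : (0 : ℝ) < (k : ℝ) - r.1.1.card :=
  sub_pos.2 (Nat.cast_lt.2 r.2.2.2)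

lemma vertexCoeff_sub_one (r : HighMedium n k) :
    ((r.1.2.card : ℝ) + k - 1) / ((k : ℝ) - r.1.1.card) - 1 =
      ((r.1.1.card : ℝ) + r.1.2.card - 1) / ((k : ℝ) - r.1.1.card) := by
  have := r.sub_card_pos.ne'
  field_simp
  ring

lemma excessLevel_vertexPoint (r : HighMedium n k) :
    excessLevel k (vertexPoint n k r) =
      ((r.1.1.card : ℝ) + r.1.2.card - 1) / ((k : ℝ) - r.1.1.card) := by
  have hk : (k : ℝ) ≠ 0 := Nat.cast_ne_zero.2 (Nat.ne_zero_of_lt r.2.2.2)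
  have := r.sub_card_pos.ne'
  rw [excessLevel, sum_vertexPoint]
  field_simp
  ring

lemma vertexPoint_of_mem_high (r : HighMedium n k) {y : Fin n} (hy : y ∈ r.1.1) :
    vertexPoint n k r y = 1 + excessLevel k (vertexPoint n k r) := by
  rw [excessLevel_vertexPoint, ← vertexCoeff_sub_one]
  simp [vertexPoint, hy, Finset.disjoint_left.1 r.2.1 hy]

lemma vertexPoint_of_mem_medium (r : HighMedium n k) {y : Fin n} (hy : y ∈ r.1.2) :
    vertexPoint n k r y = 1 := by
  simp [vertexPoint, hy, Finset.disjoint_right.1 r.2.1 hy]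

lemma vertexPoint_of_notMem (r : HighMedium n k) {y : Fin n} (hy : y ∉ r.1.1 ∪ r.1.2) :
    vertexPoint n k r y = 0 := by
  rw [Finset.mem_union, not_or] at hy
  simp [vertexPoint, hy.1, hy.2]

lemma excessLevel_vertexPoint_nonneg (r : HighMedium n k) (hr : (r.1.1 ∪ r.1.2).Nonempty) :
    0 ≤ excessLevel k (vertexPoint n k r) := by
  have hcard : (1 : ℝ) ≤ r.1.1.card + r.1.2.card := by
    rw [← Nat.cast_add, ← Finset.card_union_of_disjoint r.2.1]
    exact_mod_cast hr.card_pos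
  rw [excessLevel_vertexPoint]
  exact div_nonneg (sub_nonneg.2 hcard) r.sub_card_pos.le

lemma vertexPoint_nonneg (r : HighMedium n k) : 0 ≤ vertexPoint n k r := by
  intro y
  by_cases hH : y ∈ r.1.1
  · rw [vertexPoint_of_mem_high r hH]
    have := excessLevel_vertexPoint_nonneg r ⟨y, Finset.mem_union_left _ hH⟩
    positivity
  by_cases hM : y ∈ r.1.2
  · simp [vertexPoint_of_mem_medium r hM]
  · simp [vertexPoint_of_notMem r (y := y) (by simp [hH, hM])]

theorem surrogateL2_vertexPoint (hk : 1 ≤ k) (hkn : k < n) (r : HighMedium n k) (y : Fin n) :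
    surrogateL2 n k (vertexPoint n k r) y = hatEll2 n k r y := by
  have hlevel := excessLevel_vertexPoint r
  rw [surrogateL2_eq_excessLoss hk hkn (vertexPoint_nonneg r) r.2.2.1
    fun i hi => vertexPoint_of_notMem r hi]
  unfold hatEll2
  split_ifs with hH hM
  · have hnonneg := excessLevel_vertexPoint_nonneg r ⟨y, Finset.mem_union_left _ hH⟩
    have hy := vertexPoint_of_mem_high r hH
    rw [excessLoss_of_one_le (by linarith), hy]
    simp
  · have hy := vertexPoint_of_mem_medium r hM
    rw [excessLoss_of_one_le hy.ge, hy, ← hlevel, sub_self, sub_zero]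
    exact max_eq_left (excessLevel_vertexPoint_nonneg r ⟨y, Finset.mem_union_right _ hM⟩)
  · have hy : vertexPoint n k r y = 0 := vertexPoint_of_notMem r (by simp [hH, hM])
    have hbound := neg_one_div_le_excessLevel k (vertexPoint_nonneg r)
    have hk0 : (k : ℝ) ≠ 0 := by positivity
    rw [excessLoss_of_le_one (by omega) (by simp [hy]), hy, ← hlevel, sub_zero, mul_one]
    refine max_eq_left ?_
    rw [add_div, div_self hk0]
    linarith

end Vertices

section FractionalMinorant

variable {ι : Type*}

/-- The discrete loss `ℓ̂₂` with the high set `H` and the set `H ∪ M` replaced by fractional sets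
`a` and `b`, and the loss at a medium label replaced by a free parameter `s`. -/
noncomputable def fractionalLoss (k : ℕ) (s : ℝ) (a b : ι → ℝ) (y : ι) : ℝ :=
  s * (1 - a y) + ((k : ℝ) + 1) / k * (1 - b y)

/-- The fractional high set `min(1, (w - 1)₊ / s)`. -/
noncomputable def fractionalHigh (s : ℝ) (w : ι → ℝ) (i : ι) : ℝ :=
  min 1 (max (w i - 1) 0 / s)


lemma fractionalHigh_mem_Icc {s : ℝ} (hs : 0 ≤ s) (w : ι → ℝ) :
    fractionalHigh s w ∈ Set.Icc (0 : ι → ℝ) 1 :=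
  ⟨fun _ => le_min zero_le_one (div_nonneg (le_max_right _ _) hs), fun _ => min_le_left _ _⟩

lemma fractionalHigh_of_le_one (s : ℝ) {w : ι → ℝ} {i : ι} (hi : w i ≤ 1) :
    fractionalHigh s w i = 0 := by
  simp [fractionalHigh, max_eq_right (sub_nonpos.2 hi)]

variable [Fintype ι]

lemma mul_sum_fractionalHigh_le {s : ℝ} (hs : 0 < s) (w : ι → ℝ) :
    s * ∑ i, fractionalHigh s w i ≤ ∑ i, w i - ∑ i, min (w i) 1 := by
  rw [Finset.mul_sum, ← Finset.sum_sub_distrib]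
  gcongr with i
  calc s * fractionalHigh s w i ≤ s * (max (w i - 1) 0 / s) := by
        gcongr
        exact min_le_right _ _
    _ = max (w i - 1) 0 := mul_div_cancel₀ _ hs.ne'
    _ = w i - min (w i) 1 := by grind

lemma fractionalLoss_fractionalHigh_le {k : ℕ} (hk : k ≠ 0) {w : ι → ℝ}
    (hs : 0 < excessLevel k w) (y : ι) :
    fractionalLoss k (excessLevel k w) (fractionalHigh (excessLevel k w) w)
      (fun i => min (w i) 1) y ≤ excessLoss k w y := by
  rcases le_total (w y) 1 with hy | hy
  · rw [excessLoss_of_le_one hk hy, fractionalLoss, fractionalHigh_of_le_one _ hy, min_eq_left hy,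
      sub_zero, mul_one]
    exact le_max_left _ _
  · rw [excessLoss_of_one_le hy, fractionalLoss, fractionalHigh, min_eq_right hy,
      max_eq_left (sub_nonneg.2 hy)]
    rcases min_choice 1 ((w y - 1) / excessLevel k w) with hmin | hmin
    · simp [hmin]
    · refine le_max_of_le_left (le_of_eq ?_)
      rw [hmin]
      field_simp
      ring

lemma fractionalLoss_zero_le {k : ℕ} (hk : k ≠ 0) (w : ι → ℝ) (y : ι) :
    fractionalLoss k (min (excessLevel k w) 0) 0 (fun i => min (w i) 1) y ≤ excessLoss k w y := by
  simp only [fractionalLoss, Pi.zero_apply, sub_zero, mul_one]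
  rcases le_total (w y) 1 with hy | hy
  · rw [excessLoss_of_le_one hk hy, min_eq_left hy]
    exact le_max_of_le_left (by gcongr; exact min_le_left _ _)
  · rw [min_eq_right hy, sub_self, mul_zero, add_zero]
    exact (min_le_right _ _).trans (le_max_right _ _)

lemma exists_fractionalLoss_le_excessLoss {k : ℕ} (hk : k ≠ 0) (w : ι → ℝ) :
    ∃ (s : ℝ) (a : ι → ℝ), a ∈ Set.Icc (0 : ι → ℝ) 1 ∧ (∀ i, a i ≠ 0 → min (w i) 1 = 1) ∧
      ∑ i, a i < k ∧ ∑ i, min (w i) 1 - 1 ≤ s * ((k : ℝ) - ∑ i, a i) ∧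
      ∀ y, fractionalLoss k s a (fun i => min (w i) 1) y ≤ excessLoss k w y := by
  have hk0 : (0 : ℝ) < k := by positivity
  have hlevel : excessLevel k w * k = ∑ i, w i - 1 := div_mul_cancel₀ _ hk0.ne'
  have hle : ∑ i, min (w i) 1 ≤ ∑ i, w i := Finset.sum_le_sum fun i _ => min_le_left _ _
  -- Not split at `s = 0`: for `k = 1`, `0 < s` and `∑ b = 1`, `fractionalHigh` may sum to `k`.
  rcases le_or_gt (∑ i, min (w i) 1) 1 with hsmall | hlarge
  · refine ⟨min (excessLevel k w) 0, 0, ⟨le_rfl, zero_le_one⟩, by simp, by simpa using hk0, ?_,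
      fractionalLoss_zero_le hk w⟩
    simp only [Pi.zero_apply, Finset.sum_const_zero, sub_zero]
    rcases min_choice (excessLevel k w) 0 with hmin | hmin <;> rw [hmin] <;> linarith
  · have hs : 0 < excessLevel k w := div_pos (by linarith) hk0
    have hsum := mul_sum_fractionalHigh_le hs w
    have hbound : ∑ i, min (w i) 1 - 1 ≤
        excessLevel k w * ((k : ℝ) - ∑ i, fractionalHigh (excessLevel k w) w i) := by
      rw [mul_sub]
      linarith
    refine ⟨excessLevel k w, fractionalHigh (excessLevel k w) w, fractionalHigh_mem_Icc hs.le w,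
      fun i hi => ?_, ?_, hbound, fractionalLoss_fractionalHigh_le hk hs⟩
    · exact min_eq_right (le_of_not_ge fun hwi => hi (fractionalHigh_of_le_one _ hwi))
    · exact sub_pos.1 (pos_of_mul_pos_right (by linarith) hs.le)

end FractionalMinorant

section Rounding

variable {ι : Type*} [Fintype ι]

lemma exists_sum_mul_indicator_le (x : ι → ℝ) {a : ι → ℝ} (ha : a ∈ Set.Icc (0 : ι → ℝ) 1) :
    ∃ H : Finset ι, (∀ i ∈ H, a i ≠ 0) ∧ (∀ i, a i = 1 → i ∈ H) ∧
      ∑ i, x i * (H : Set ι).indicator 1 i ≤ ∑ i, x i * a i := by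
  classical
  refine ⟨Finset.univ.filter fun i => a i = 1 ∨ a i ≠ 0 ∧ x i < 0, fun i hi => ?_,
    by simp +contextual, ?_⟩
  · rcases (Finset.mem_filter_univ i).1 hi with h | h
    · simp [h]
    · exact h.1
  refine Finset.sum_le_sum fun i _ => ?_
  have h0 : 0 ≤ a i := ha.1 i
  have h1 : a i ≤ 1 := ha.2 i
  by_cases hi : a i = 1 ∨ a i ≠ 0 ∧ x i < 0
  · simp only [Set.indicator_apply, Finset.mem_coe, Finset.mem_filter_univ, hi, if_true,
      Pi.one_apply]
    rcases hi with hi | hi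
    · rw [hi]
    · nlinarith
  · simp only [Set.indicator_apply, Finset.mem_coe, Finset.mem_filter_univ, hi, if_false, mul_zero]
    push Not at hi
    by_cases ha0 : a i = 0
    · simp [ha0]
    · exact mul_nonneg (hi.2 ha0) h0

lemma sum_mul_fractionalLoss {p : ι → ℝ} (hp : ∑ y, p y = 1) (k : ℕ) (s : ℝ) (a b : ι → ℝ) :
    ∑ y, p y * fractionalLoss k s a b y =
      s * (1 - ∑ y, p y * a y) + ((k : ℝ) + 1) / k * (1 - ∑ y, p y * b y) := by
  have hterm (c : ℝ) (x : ι → ℝ) : ∑ y, p y * (c * (1 - x y)) = c * (1 - ∑ y, p y * x y) := by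
    calc ∑ y, p y * (c * (1 - x y)) = ∑ y, c * (p y - p y * x y) :=
          Finset.sum_congr rfl fun y _ => by ring
      _ = c * (1 - ∑ y, p y * x y) := by rw [← Finset.mul_sum, Finset.sum_sub_distrib, hp]
  simp only [fractionalLoss, mul_add, Finset.sum_add_distrib, hterm]

/-- For a probability vector `p`, the difference between the `p`-expected fractional loss at level
`(∑ b - 1) / (k - ∑ a)` and `V`, multiplied by `k - ∑ a` so as to be affine in `a` and in `b`. -/
noncomputable def fractionalGap (k : ℕ) (p : ι → ℝ) (V : ℝ) (a b : ι → ℝ) : ℝ :=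
  (∑ i, b i - 1) * (1 - ∑ i, p i * a i) +
    ((k : ℝ) - ∑ i, a i) * (((k : ℝ) + 1) / k * (1 - ∑ i, p i * b i) - V)

lemma exists_fractionalGap_indicator_left_le (k : ℕ) (p : ι → ℝ) (V : ℝ) {a : ι → ℝ}
    (ha : a ∈ Set.Icc (0 : ι → ℝ) 1) (b : ι → ℝ) :
    ∃ H : Finset ι, (∀ i ∈ H, a i ≠ 0) ∧
      fractionalGap k p V ((H : Set ι).indicator 1) b ≤ fractionalGap k p V a b := by
  set c := ((k : ℝ) + 1) / k * (1 - ∑ i, p i * b i) - V with hc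
  have haffine (a' : ι → ℝ) : fractionalGap k p V a' b =
      ∑ i, b i - 1 + k * c + ∑ i, (-(∑ i, b i - 1) * p i - c) * a' i := by
    simp only [fractionalGap, ← hc, sub_mul, Finset.sum_sub_distrib, mul_assoc, ← Finset.mul_sum]
    ring
  obtain ⟨H, hH, -, hle⟩ :=
    exists_sum_mul_indicator_le (fun i => -(∑ i, b i - 1) * p i - c) ha
  refine ⟨H, hH, ?_⟩
  rw [haffine, haffine]
  gcongr

lemma exists_fractionalGap_indicator_right_le (k : ℕ) (p : ι → ℝ) (V : ℝ) (a : ι → ℝ)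
    {b : ι → ℝ} (hb : b ∈ Set.Icc (0 : ι → ℝ) 1) :
    ∃ B : Finset ι, (∀ i ∈ B, b i ≠ 0) ∧ (∀ i, b i = 1 → i ∈ B) ∧
      fractionalGap k p V a ((B : Set ι).indicator 1) ≤ fractionalGap k p V a b := by
  set q := 1 - ∑ i, p i * a i with hq
  set c := ((k : ℝ) - ∑ i, a i) * (((k : ℝ) + 1) / k) with hc
  have haffine (b' : ι → ℝ) : fractionalGap k p V a b' =
      c - q - ((k : ℝ) - ∑ i, a i) * V + ∑ i, (q - c * p i) * b' i := by
    simp only [fractionalGap, ← hq, sub_mul, Finset.sum_sub_distrib, mul_assoc, ← Finset.mul_sum]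
    rw [hc]
    ring
  obtain ⟨B, hB, hB', hle⟩ := exists_sum_mul_indicator_le (fun i => q - c * p i) hb
  refine ⟨B, hB, hB', ?_⟩
  rw [haffine, haffine]
  gcongr

lemma le_sum_mul_fractionalLoss {k : ℕ} {p : ι → ℝ} {V s : ℝ} {a b : ι → ℝ}
    (hp : p ∈ stdSimplex ℝ ι)
    (ha : a ≤ 1) (hak : ∑ i, a i < k) (hs : ∑ i, b i - 1 ≤ s * ((k : ℝ) - ∑ i, a i))
    (hgap : 0 ≤ fractionalGap k p V a b) : V ≤ ∑ y, p y * fractionalLoss k s a b y := by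
  have hpa : ∑ i, p i * a i ≤ 1 := by
    rw [← hp.2]
    exact Finset.sum_le_sum fun i _ => mul_le_of_le_one_right (hp.1 i) (ha i)
  have hscaled := mul_le_mul_of_nonneg_right hs (sub_nonneg.2 hpa)
  rw [sum_mul_fractionalLoss hp.2]
  refine le_of_mul_le_mul_left ?_ (sub_pos.2 hak)
  rw [fractionalGap] at hgap
  linarith

end Rounding

section Optimality

variable {n k : ℕ} {p : Fin n → ℝ} {V : ℝ}

lemma hatEll2_eq_fractionalLoss (r : HighMedium n k) (y : Fin n) :
    hatEll2 n k r y =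
      fractionalLoss k ((((r.1.1 ∪ r.1.2).card : ℝ) - 1) / ((k : ℝ) - r.1.1.card))
        ((r.1.1 : Set (Fin n)).indicator 1)
        (((r.1.1 ∪ r.1.2 : Finset (Fin n)) : Set (Fin n)).indicator 1) y := by
  rw [Finset.card_union_of_disjoint r.2.1]
  by_cases hH : y ∈ r.1.1 <;> by_cases hM : y ∈ r.1.2 <;> simp [hatEll2, fractionalLoss, hH, hM]

lemma fractionalGap_indicator_nonneg (hk : 1 ≤ k) (hp : p ∈ stdSimplex ℝ (Fin n))
    (hV : ∀ r : HighMedium n k, V ≤ expectedLoss (hatEll2 n k) p r) {H B : Finset (Fin n)}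
    (hHB : H ⊆ B) (hB : B.card ≤ k) :
    0 ≤ fractionalGap k p V ((H : Set (Fin n)).indicator 1) ((B : Set (Fin n)).indicator 1) := by
  have hcard (A : Finset (Fin n)) :
      ∑ i, (A : Set (Fin n)).indicator (1 : Fin n → ℝ) i = A.card := by
    simp [Set.indicator_apply]
  rw [fractionalGap, hcard, hcard]
  rcases ((Finset.card_le_card hHB).trans hB).eq_or_lt with hHk | hHk
  · have hB1 : (1 : ℝ) ≤ B.card := by
      exact_mod_cast (hk.trans_eq hHk.symm).trans (Finset.card_le_card hHB)
    have hpH : ∑ i, p i * (H : Set (Fin n)).indicator 1 i ≤ 1 := by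
      rw [← hp.2]
      exact Finset.sum_le_sum fun i _ => mul_le_of_le_one_right (hp.1 i)
        (Set.indicator_le_self' (fun _ _ => zero_le_one) i)
    rw [hHk, sub_self, zero_mul, add_zero]
    exact mul_nonneg (sub_nonneg.2 hB1) (sub_nonneg.2 hpH)
  · have hunion : H ∪ B \ H = B := Finset.union_sdiff_of_subset hHB
    have hr := hV ⟨(H, B \ H), Finset.disjoint_sdiff, hunion.symm ▸ hB, hHk⟩
    have hpos : (0 : ℝ) < (k : ℝ) - H.card := sub_pos.2 (Nat.cast_lt.2 hHk)
    simp only [expectedLoss, hatEll2_eq_fractionalLoss, sum_mul_fractionalLoss hp.2, hunion] at hr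
    have hscaled := mul_le_mul_of_nonneg_left hr hpos.le
    rw [mul_add, ← mul_assoc, mul_div_cancel₀ _ hpos.ne'] at hscaled
    linarith

lemma fractionalGap_nonneg (hk : 1 ≤ k) (hp : p ∈ stdSimplex ℝ (Fin n))
    (hV : ∀ r : HighMedium n k, V ≤ expectedLoss (hatEll2 n k) p r) {a b : Fin n → ℝ}
    (ha : a ∈ Set.Icc (0 : Fin n → ℝ) 1) (hb : b ∈ Set.Icc (0 : Fin n → ℝ) 1)
    (hab : ∀ i, a i ≠ 0 → b i = 1) {A : Finset (Fin n)} (hA : A.card ≤ k)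
    (hbA : ∀ i ∉ A, b i = 0) : 0 ≤ fractionalGap k p V a b := by
  obtain ⟨H, hHa, hleH⟩ := exists_fractionalGap_indicator_left_le k p V ha b
  obtain ⟨B, hBb, hbB, hleB⟩ :=
    exists_fractionalGap_indicator_right_le k p V ((H : Set (Fin n)).indicator 1) hb
  have hHB : H ⊆ B := fun i hi => hbB i (hab i (hHa i hi))
  have hBA : B ⊆ A := fun i hi => not_not.1 fun hiA => hBb i hi (hbA i hiA)
  exact (fractionalGap_indicator_nonneg hk hp hV hHB ((Finset.card_le_card hBA).trans hA)).trans
    (hleB.trans hleH)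

theorem le_expectedLoss_surrogateL2 (hk : 1 ≤ k) (hkn : k < n) (hp : p ∈ stdSimplex ℝ (Fin n))
    (hV : ∀ r : HighMedium n k, V ≤ expectedLoss (hatEll2 n k) p r) (u : Fin n → ℝ) :
    V ≤ expectedLoss (surrogateL2 n k) p u := by
  obtain ⟨w, A, hw, hA, hwA, hwu⟩ := exists_excessLoss_le_surrogateL2 hk hkn u
  obtain ⟨s, a, ha, hab, hak, hs, hle⟩ :=
    exists_fractionalLoss_le_excessLoss (Nat.one_le_iff_ne_zero.1 hk) w
  have hb : (fun i => min (w i) 1) ∈ Set.Icc (0 : Fin n → ℝ) 1 :=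
    ⟨fun i => le_min (hw i) zero_le_one, fun i => min_le_right _ _⟩
  have hgap := fractionalGap_nonneg hk hp hV ha hb hab hA.le fun i hi => by simp [hwA i hi]
  refine (le_sum_mul_fractionalLoss hp ha.2 hak hs hgap).trans ?_
  exact Finset.sum_le_sum fun y _ =>
    mul_le_mul_of_nonneg_left ((hle y).trans (hwu y)) (hp.1 y)

theorem isRepresentative_vertexSetR2 (hk : 1 ≤ k) (hkn : k < n) :
    IsRepresentative (surrogateL2 n k) (vertexSetR2 n k) := by
  intro p hp
  have : Nonempty (HighMedium n k) := ⟨⟨(∅, ∅), by simp, by simp, hk⟩⟩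
  obtain ⟨r, hr⟩ := Finite.exists_min (expectedLoss (hatEll2 n k) p)
  refine ⟨vertexPoint n k r, fun u => ?_, r, rfl⟩
  calc expectedLoss (surrogateL2 n k) p (vertexPoint n k r) = expectedLoss (hatEll2 n k) p r := by
        simp only [expectedLoss, surrogateL2_vertexPoint hk hkn]
    _ ≤ expectedLoss (surrogateL2 n k) p u := le_expectedLoss_surrogateL2 hk hkn hp hr u

end Optimality

section Embedding

variable {R Y : Type*} [Fintype Y]

lemma expectedLoss_comp {R' : Type*} {L : R' → Y → ℝ} {ℓ : R → Y → ℝ} {ψ : R → R'}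
    (hψ : ∀ r y, L (ψ r) y = ℓ r y) (p : Y → ℝ) (r : R) :
    expectedLoss L p (ψ r) = expectedLoss ℓ p r := by
  simp only [expectedLoss, hψ]

lemma mem_elicitedProp_iff_of_isRepresentative_range {R' : Type*} {L : R' → Y → ℝ}
    {ℓ : R → Y → ℝ} {ψ : R → R'} (hψ : ∀ r y, L (ψ r) y = ℓ r y)
    (hrep : IsRepresentative L (Set.range ψ)) {p : Y → ℝ} (hp : p ∈ stdSimplex ℝ Y) (r : R) :
    r ∈ elicitedProp ℓ p ↔ ψ r ∈ elicitedProp L p := by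
  refine ⟨fun hr u => ?_, fun hr r' => ?_⟩
  · obtain ⟨_, hopt, r₀, rfl⟩ := hrep p hp
    calc expectedLoss L p (ψ r) = expectedLoss ℓ p r := expectedLoss_comp hψ p r
      _ ≤ expectedLoss ℓ p r₀ := hr r₀
      _ = expectedLoss L p (ψ r₀) := (expectedLoss_comp hψ p r₀).symm
      _ ≤ expectedLoss L p u := hopt u
  · rw [← expectedLoss_comp hψ, ← expectedLoss_comp hψ]
    exact hr (ψ r')

theorem embeds_of_isRepresentative_range [Finite R] {d : ℕ} {L : (Fin d → ℝ) → Y → ℝ}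
    {ℓ : R → Y → ℝ} {ψ : R → Fin d → ℝ} (hL : ∀ u y, 0 ≤ L u y)
    (hψ : ∀ r y, L (ψ r) y = ℓ r y) (hrep : IsRepresentative L (Set.range ψ)) : Embeds L ℓ := by
  -- `ψ` need not be injective: keep one report from each of its fibres.
  obtain ⟨S, hS, hinj⟩ := Set.exists_image_eq_and_injOn Set.univ ψ
  rw [Set.image_univ] at hS
  refine ⟨hL, inferInstance, fun r y => hψ r y ▸ hL (ψ r) y, S, fun p hp => ?_, fun r => ψ r,
    hinj.injective, fun r => hψ r,
    fun p hp r => mem_elicitedProp_iff_of_isRepresentative_range hψ hrep hp r⟩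
  rw [← hS] at hrep
  obtain ⟨_, hopt, r, hrS, rfl⟩ := hrep p hp
  exact ⟨r, (mem_elicitedProp_iff_of_isRepresentative_range hψ (hS ▸ hrep) hp r).2 hopt, hrS⟩

end Embedding

theorem mainTheorem7 (n k : ℕ) (hk : 1 ≤ k) (hkn : k < n) :
    (vertexSetR2 n k).Finite ∧
    IsRepresentative (surrogateL2 n k) (vertexSetR2 n k) ∧
    Embeds (surrogateL2 n k) (restrictLoss (surrogateL2 n k) (vertexSetR2 n k)) ∧
    (∀ (r : HighMedium n k) (y : Fin n),
      surrogateL2 n k (vertexPoint n k r) y = hatEll2 n k r y) ∧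
    Embeds (surrogateL2 n k) (hatEll2 n k) := by
  have hfin : (vertexSetR2 n k).Finite := Set.finite_range _
  have hrep := isRepresentative_vertexSetR2 hk hkn
  have : Finite (vertexSetR2 n k) := hfin
  refine ⟨hfin, hrep, ?_, surrogateL2_vertexPoint hk hkn, ?_⟩
  · exact embeds_of_isRepresentative_range (ψ := Subtype.val) surrogateL2_nonneg
      (fun _ _ => rfl) (by rwa [Subtype.range_coe])
  · exact embeds_of_isRepresentative_range surrogateL2_nonneg (surrogateL2_vertexPoint hk hkn) hrep
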